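/- For a set $\Gamma$ of isometries of $\mathbb{R}$, a $\Gamma$-equidecomposition of $A,B\subseteq\mathbb{R}$ consists of finite partitions $A=A_1\sqcup\dots\sqcup A_k$, $B=B_1\sqcup\dots\sqcup B_k$ and (not necessarily distinct) isometries $\gamma_1,\dots,\gamma_k\in\Gamma$ with $\gamma_i(A_i)=B_i$ for every $i$; it is measurable if all the sets $A_i$ and $B_i$ are Lebesgue measurable. Let $0<\alpha<1$ be irrational, let $$\Gamma=\{x\mapsto x,\ x\mapsto x+2\alpha,\ x\mapsto 2-x,\ x\mapsto 2\alpha-x\},$$ and let $\langle\Gamma\rangle$ be the group of isometries of $\mathbb{R}$ generated by $\Gamma$. Then the intervals $A=[0,1]$ and $B=[\alpha,1+\alpha]$ admit a $\Gamma$-equidecomposition, but no measurable $\langle\Gamma\rangle$-equidecomposition. -/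

import Mathlib

/-- The indexed family `P` is a partition of the set `A` (some members may be empty). -/
def IsFinPartition {X : Type*} {k : ℕ} (P : Fin k → Set X) (A : Set X) : Prop :=
  (⋃ i, P i) = A ∧ Pairwise (fun i j => Disjoint (P i) (P j))

/-- `P`, `Q`, `g` form an equidecomposition of `A` and `B` by isometries in `Γ`: the pieces
`P i` partition `A`, the pieces `Q i` partition `B`, and `g i ∈ Γ` maps `P i` onto `Q i`. -/
structure IsEquidecomposition {X : Type*} [PseudoEMetricSpace X] (Γ : Set (X ≃ᵢ X))
    (A B : Set X) {k : ℕ} (P Q : Fin k → Set X) (g : Fin k → (X ≃ᵢ X)) : Prop where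
  partition_left : IsFinPartition P A
  partition_right : IsFinPartition Q B
  mem : ∀ i, g i ∈ Γ
  image_eq : ∀ i, g i '' P i = Q i

/-- `A` and `B` are `Γ`-equidecomposable. -/
def Equidecomposable {X : Type*} [PseudoEMetricSpace X] (Γ : Set (X ≃ᵢ X))
    (A B : Set X) : Prop :=
  ∃ (k : ℕ) (P Q : Fin k → Set X) (g : Fin k → (X ≃ᵢ X)), IsEquidecomposition Γ A B P Q g

/-- `A, B ⊆ ℝ` admit a `Γ`-equidecomposition all of whose pieces are Lebesgue measurable
(that is, measurable with respect to the completion of the Borel σ-algebra). -/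
def MeasurablyEquidecomposable (Γ : Set (ℝ ≃ᵢ ℝ)) (A B : Set ℝ) : Prop :=
  ∃ (k : ℕ) (P Q : Fin k → Set ℝ) (g : Fin k → (ℝ ≃ᵢ ℝ)),
    IsEquidecomposition Γ A B P Q g ∧
    (∀ i, MeasureTheory.NullMeasurableSet (P i) MeasureTheory.volume) ∧
    (∀ i, MeasureTheory.NullMeasurableSet (Q i) MeasureTheory.volume)

/-- The four isometries `x ↦ x`, `x ↦ x + 2α`, `x ↦ 2 - x`, `x ↦ 2α - x` of the real line. -/
noncomputable def fourIsometries (α : ℝ) : Set (ℝ ≃ᵢ ℝ) :=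
  {IsometryEquiv.refl ℝ, IsometryEquiv.addRight (2 * α), IsometryEquiv.subLeft 2,
    IsometryEquiv.subLeft (2 * α)}

/-! No measurable equidecomposition: map the line to the circle `ℝ/2ℤ`. The image of `A`, and
likewise that of `B` reflected about `α`, tiles the circle with its mirror image up to null sets.
For each piece `P` moved by `g`, the function `1_{gP}(θ + 2α) + 1_{gP}(-θ) - 1_P(θ) - 1_P(-θ)` is
the coboundary of an integer-valued `G` under rotation by `2α`, with `∫ G = -|P|` whatever `g` is
(`exists_transfer_of_isometry`). Summed over the pieces, the coboundaries become `1 - 1 = 0` almost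
everywhere. By ergodicity `∑ G` is a constant integer `c`, so `2c = -1`, which is absurd.

Equidecomposition: the axiom of choice gives an injection of `[0,1]` into itself moving each point
by `±α` and folding at the endpoints (`exists_injOn_reflected_shift`). It induces injections `A → B`
and `B → A` along the isometries in `Γ`. Schröder–Bernstein combines them into a bijection, and the
finiteness of `Γ` makes it an equidecomposition. -/

/-! ### Integer-valued coboundaries and ergodicity -/

-- Telescoping: for `n ≥ 0` take `G θ = ∑_{0 ≤ j < n} g (θ - j • a)`, and for `n < 0` minus the sum
-- over `n ≤ j < 0`. The integral thus records the signed number of steps.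
open MeasureTheory in
theorem exists_integer_transfer {C : Type*} [AddCommGroup C] [MeasurableSpace C]
    [MeasurableAdd C] {μ : Measure C} [μ.IsAddRightInvariant] {g : C → ℝ}
    (hg : Integrable g μ) (hz : ∀ θ, ∃ z : ℤ, g θ = z) (a : C) (n : ℤ) :
    ∃ G : C → ℝ, Integrable G μ ∧ (∀ θ, ∃ z : ℤ, G θ = z) ∧
      (∀ θ, G (θ - a) - G θ = g (θ - n • a) - g θ) ∧ ∫ θ, G θ ∂μ = n * ∫ θ, g θ ∂μ := by
  induction n using Int.induction_on with
  | zero => exact ⟨0, integrable_zero _ _ _, fun θ => ⟨0, by simp⟩, by simp, by simp⟩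
  | succ n ih =>
    obtain ⟨G, hG, hGz, hGs, hGi⟩ := ih
    have hs : Integrable (fun θ => g (θ - (n : ℤ) • a)) μ := hg.comp_sub_right _
    refine ⟨fun θ => G θ + g (θ - (n : ℤ) • a), hG.add hs, fun θ => ?_, fun θ => ?_, ?_⟩
    · obtain ⟨u, hu⟩ := hGz θ
      obtain ⟨v, hv⟩ := hz (θ - (n : ℤ) • a)
      exact ⟨u + v, by simp only [hu, hv]; push_cast; rfl⟩
    · have h := hGs θ
      have e : θ - a - (n : ℤ) • a = θ - ((n : ℤ) + 1) • a := by rw [add_smul, one_smul]; abel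
      simp only [e]
      linarith
    · rw [integral_add hG hs, hGi, integral_sub_right_eq_self g]
      push_cast
      ring
  | pred n ih =>
    obtain ⟨G, hG, hGz, hGs, hGi⟩ := ih
    have hs : Integrable (fun θ => g (θ - (-(n : ℤ) - 1) • a)) μ := hg.comp_sub_right _
    refine ⟨fun θ => G θ - g (θ - (-(n : ℤ) - 1) • a), hG.sub hs, fun θ => ?_, fun θ => ?_, ?_⟩
    · obtain ⟨u, hu⟩ := hGz θ
      obtain ⟨v, hv⟩ := hz (θ - (-(n : ℤ) - 1) • a)
      exact ⟨u - v, by simp only [hu, hv]; push_cast; rfl⟩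
    · have h := hGs θ
      have e : θ - a - (-(n : ℤ) - 1) • a = θ - (-(n : ℤ)) • a := by
        rw [sub_smul, one_smul]; abel
      simp only [e]
      linarith
    · rw [integral_sub hG hs, hGi, integral_sub_right_eq_self g]
      push_cast
      ring

/-- An integer-valued integrable function invariant under an ergodic map has integral an integer
multiple of the total mass. -/
theorem Ergodic.exists_integral_eq_intCast_mul {C : Type*} [MeasurableSpace C]
    {μ : MeasureTheory.Measure C} [NeZero μ] {T : C → C} (hT : Ergodic T μ)
    {F : C → ℝ} (hF : MeasureTheory.Integrable F μ) (hz : ∀ θ, ∃ z : ℤ, F θ = z)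
    (hinv : F ∘ T =ᵐ[μ] F) : ∃ c : ℤ, ∫ θ, F θ ∂μ = c * μ.real Set.univ := by
  obtain ⟨c, hc⟩ := hT.ae_eq_const_of_ae_eq_comp_ae hF.aestronglyMeasurable hinv
  obtain ⟨θ, hθ⟩ := hc.exists
  obtain ⟨z, hz⟩ := hz θ
  refine ⟨z, ?_⟩
  rw [MeasureTheory.integral_congr_ae hc, ← hz, hθ]
  simp [mul_comm]

/-! ### Partitions and indicators on the circle of length 2 -/

theorem IsFinPartition.image {X Y : Type*} {k : ℕ} {P : Fin k → Set X} {A : Set X}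
    (h : IsFinPartition P A) {f : X → Y} (hf : Set.InjOn f A) :
    IsFinPartition (fun i => f '' P i) (f '' A) := by
  have hs : ∀ i, P i ⊆ A := fun i => h.1 ▸ Set.subset_iUnion P i
  refine ⟨by rw [← Set.image_iUnion, h.1], fun i j hij => ?_⟩
  exact Set.disjoint_image_image fun x hx y hy e =>
    Set.disjoint_left.1 (h.2 hij) hx (hf (hs i hx) (hs j hy) e ▸ hy)

theorem IsFinPartition.sum_indicator_one {X : Type*} {k : ℕ} {P : Fin k → Set X} {A : Set X}
    (h : IsFinPartition P A) (x : X) :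
    ∑ i, (P i).indicator (1 : X → ℝ) x = A.indicator 1 x := by
  by_cases hx : x ∈ A
  · obtain ⟨i, hi⟩ := Set.mem_iUnion.1 (h.1.symm ▸ hx)
    rw [Finset.sum_eq_single i, Set.indicator_of_mem hi, Set.indicator_of_mem hx]
    · intro j _ hj
      exact Set.indicator_of_notMem (Set.disjoint_right.1 (h.2 hj) hi) _
    · simp
  · rw [Set.indicator_of_notMem hx]
    refine Finset.sum_eq_zero fun i _ => Set.indicator_of_notMem (fun hi => hx ?_) _
    exact h.1 ▸ Set.mem_iUnion_of_mem i hi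

theorem Set.indicator_one_eq_of_mem_iff {X : Type*} {s t : Set X} {x y : X}
    (h : x ∈ s ↔ y ∈ t) : s.indicator (1 : X → ℝ) x = t.indicator 1 y := by
  by_cases hx : x ∈ s
  · rw [Set.indicator_of_mem hx, Set.indicator_of_mem (h.1 hx)]
    rfl
  · rw [Set.indicator_of_notMem hx, Set.indicator_of_notMem (mt h.2 hx)]

instance : Fact ((0 : ℝ) < 2) := ⟨two_pos⟩

/-- The indicator function, on the circle of length `2`, of the image of a subset of the line. -/
noncomputable def circleIndicator (S : Set ℝ) : AddCircle (2 : ℝ) → ℝ :=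
  ((↑) '' S : Set (AddCircle (2 : ℝ))).indicator 1

theorem injOn_coe_addCircle_Ioc (a : ℝ) :
    Set.InjOn ((↑) : ℝ → AddCircle (2 : ℝ)) (Set.Ioc a (a + 2)) :=
  fun _ hx _ hy h => (AddCircle.coe_eq_coe_iff_of_mem_Ioc hx hy).1 h

theorem IsFinPartition.sum_circleIndicator {k : ℕ} {P : Fin k → Set ℝ} {A : Set ℝ} {a : ℝ}
    (h : IsFinPartition P A) (hA : A ⊆ Set.Ioc a (a + 2)) (θ : AddCircle (2 : ℝ)) :
    ∑ i, circleIndicator (P i) θ = circleIndicator A θ :=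
  (h.image ((injOn_coe_addCircle_Ioc a).mono hA)).sum_indicator_one θ

theorem circleIndicator_integer (S : Set ℝ) (θ : AddCircle (2 : ℝ)) :
    ∃ z : ℤ, circleIndicator S θ = z := by
  by_cases h : θ ∈ ((↑) '' S : Set (AddCircle (2 : ℝ)))
  · exact ⟨1, by simp [circleIndicator, h]⟩
  · exact ⟨0, by rw [circleIndicator, Set.indicator_of_notMem h]; simp⟩

open MeasureTheory in
theorem measurePreserving_coe_equivIoc (a : ℝ) :
    MeasurePreserving (fun θ : AddCircle (2 : ℝ) => (AddCircle.equivIoc 2 a θ : ℝ)) volume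
      (volume.restrict (Set.Ioc a (a + 2))) :=
  (measurePreserving_subtype_coe measurableSet_Ioc).comp (AddCircle.measurePreserving_equivIoc 2)

theorem preimage_coe_equivIoc {a : ℝ} {S : Set ℝ} (hS : S ⊆ Set.Ioc a (a + 2)) :
    (fun θ : AddCircle (2 : ℝ) => (AddCircle.equivIoc 2 a θ : ℝ)) ⁻¹' S = (↑) '' S := by
  ext θ
  constructor
  · intro h
    exact ⟨_, h, (AddCircle.equivIoc 2 a).symm_apply_apply θ⟩
  · rintro ⟨x, hx, rfl⟩
    have := (AddCircle.equivIoc 2 a).apply_symm_apply ⟨x, hS hx⟩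
    change ((AddCircle.equivIoc 2 a (x : AddCircle (2 : ℝ)) : ℝ)) ∈ S
    have e : (AddCircle.equivIoc 2 a (x : AddCircle (2 : ℝ)) : ℝ) = x := congrArg Subtype.val this
    rwa [e]

open MeasureTheory in
theorem nullMeasurableSet_coe_image {a : ℝ} {S : Set ℝ} (hS : S ⊆ Set.Ioc a (a + 2))
    (hm : NullMeasurableSet S) :
    NullMeasurableSet ((↑) '' S : Set (AddCircle (2 : ℝ))) := by
  rw [← preimage_coe_equivIoc hS]
  exact (hm.mono Measure.restrict_le_self).preimage
    (measurePreserving_coe_equivIoc a).quasiMeasurePreserving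

open MeasureTheory in
theorem volume_coe_image {a : ℝ} {S : Set ℝ} (hS : S ⊆ Set.Ioc a (a + 2))
    (hm : NullMeasurableSet S) :
    volume ((↑) '' S : Set (AddCircle (2 : ℝ))) = volume S := by
  rw [← preimage_coe_equivIoc hS, (measurePreserving_coe_equivIoc a).measure_preimage
    (hm.mono Measure.restrict_le_self), Measure.restrict_eq_self _ hS]

open MeasureTheory in
theorem integrable_circleIndicator {a : ℝ} {S : Set ℝ} (hS : S ⊆ Set.Ioc a (a + 2))
    (hm : NullMeasurableSet S) : Integrable (circleIndicator S) :=
  (integrable_const (1 : ℝ)).indicator₀ (nullMeasurableSet_coe_image hS hm)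

open MeasureTheory in
theorem integral_circleIndicator {a : ℝ} {S : Set ℝ} (hS : S ⊆ Set.Ioc a (a + 2))
    (hm : NullMeasurableSet S) : ∫ θ, circleIndicator S θ = volume.real S := by
  rw [circleIndicator, integral_indicator₀ (nullMeasurableSet_coe_image hS hm)]
  simp [Measure.real, volume_coe_image hS hm]

theorem circleIndicator_translate {P : Set ℝ} {g : ℝ → ℝ} {c : ℝ} {b : AddCircle (2 : ℝ)}
    (hb : (c : AddCircle (2 : ℝ)) = b) (hg : ∀ x, g x = x + c) (θ : AddCircle (2 : ℝ)) :
    circleIndicator (g '' P) θ = circleIndicator P (θ - b) := by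
  refine Set.indicator_one_eq_of_mem_iff ?_
  simp only [Set.mem_image, exists_exists_and_eq_and, hg, AddCircle.coe_add, hb, eq_sub_iff_add_eq]

theorem circleIndicator_reflect {P : Set ℝ} {g : ℝ → ℝ} {c : ℝ} {b : AddCircle (2 : ℝ)}
    (hb : (c : AddCircle (2 : ℝ)) = b) (hg : ∀ x, g x = -x + c) (θ : AddCircle (2 : ℝ)) :
    circleIndicator (g '' P) θ = circleIndicator P (b - θ) := by
  refine Set.indicator_one_eq_of_mem_iff ?_
  simp only [Set.mem_image, exists_exists_and_eq_and, hg, AddCircle.coe_add, AddCircle.coe_neg, hb]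
  refine exists_congr fun x => and_congr_right fun _ => ⟨?_, ?_⟩ <;> intro h
  · rw [← h]; abel
  · rw [h]; abel

-- `[0,1]` and `[-1,0]` tile the circle, overlapping only at the classes of `0` and `1`.
open MeasureTheory in
theorem ae_circleIndicator_add_neg :
    ∀ᵐ θ : AddCircle (2 : ℝ),
      circleIndicator (Set.Icc 0 1) θ + circleIndicator (Set.Icc 0 1) (-θ) = 1 := by
  have h0 : ∀ z : AddCircle (2 : ℝ), ∀ᵐ θ : AddCircle (2 : ℝ), θ ≠ z := fun z => by
    have : volume ({z} : Set (AddCircle (2 : ℝ))) = 0 := by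
      rw [← Metric.closedBall_zero, AddCircle.volume_closedBall]
      simp
    exact compl_mem_ae_iff.2 this
  filter_upwards [h0 0, h0 ((1 : ℝ) : AddCircle (2 : ℝ))] with θ hθ0 hθ1
  obtain ⟨⟨x, hx⟩, rfl⟩ := (AddCircle.equivIoc 2 (-1)).symm.surjective θ
  change ((x : ℝ) : AddCircle (2 : ℝ)) ≠ 0 at hθ0
  change ((x : ℝ) : AddCircle (2 : ℝ)) ≠ _ at hθ1
  change circleIndicator (Set.Icc 0 1) (x : AddCircle (2 : ℝ)) +
    circleIndicator (Set.Icc 0 1) (-(x : AddCircle (2 : ℝ))) = 1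
  have hx0 : x ≠ 0 := by rintro rfl; simp at hθ0
  have hx1 : x ≠ 1 := by rintro rfl; simp at hθ1
  have key : ∀ y : ℝ, y ∈ Set.Ioc (-1 : ℝ) (-1 + 2) →
      circleIndicator (Set.Icc 0 1) (y : AddCircle (2 : ℝ)) = if 0 ≤ y then 1 else 0 := by
    intro y hy
    have : ((y : AddCircle (2 : ℝ)) ∈
        ((↑) '' Set.Icc (0 : ℝ) 1 : Set (AddCircle (2 : ℝ)))) ↔ 0 ≤ y := by
      rw [(injOn_coe_addCircle_Ioc (-1)).mem_image_iff _ hy]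
      · simp only [Set.mem_Icc, and_iff_left_iff_imp]
        intro _; linarith [hy.2]
      · intro z hz; constructor <;> linarith [hz.1, hz.2]
    split_ifs with h
    · exact Set.indicator_of_mem (this.2 h) _
    · exact Set.indicator_of_notMem (mt this.1 h) _
  have hlt : x < 1 := lt_of_le_of_ne (by linarith [hx.2]) hx1
  rw [← AddCircle.coe_neg, key x hx, key (-x) ⟨by linarith, by linarith [hx.1]⟩]
  rcases lt_or_gt_of_ne hx0 with h | h
  · rw [if_neg (by linarith), if_pos (by linarith), zero_add]
  · rw [if_pos (by linarith), if_neg (by linarith), add_zero]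

/-! ### The generated group and the measurable obstruction -/

theorem ergodic_sub_two_mul {α : ℝ} (hα : Irrational α) :
    Ergodic (fun θ : AddCircle (2 : ℝ) => θ - ((2 * α : ℝ) : AddCircle (2 : ℝ)))
      MeasureTheory.volume := by
  simp only [sub_eq_add_neg]
  rw [AddCircle.ergodic_add_right, addOrderOf_neg, ← AddCircle.denseRange_zsmul_iff,
    AddCircle.denseRange_zsmul_coe_iff, mul_div_cancel_left₀ _ two_ne_zero]
  exact hα

theorem isometry_of_mem_closure_fourIsometries {α : ℝ} {g : ℝ ≃ᵢ ℝ}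
    (hg : g ∈ Subgroup.closure (fourIsometries α)) :
    ∃ m n : ℤ, (∀ x, g x = x + (2 * m + 2 * n * α)) ∨ (∀ x, g x = -x + (2 * m + 2 * n * α)) := by
  induction hg using Subgroup.closure_induction with
  | mem g hg =>
    rcases hg with rfl | rfl | rfl | rfl
    · exact ⟨0, 0, .inl fun x => (by simp : x = x + (2 * (0 : ℤ) + 2 * (0 : ℤ) * α))⟩
    · exact ⟨0, 1, .inl fun x => by simp⟩
    · exact ⟨1, 0, .inr fun x => by simp; ring⟩
    · exact ⟨0, 1, .inr fun x => by simp; ring⟩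
  | one => exact ⟨0, 0, .inl fun x => by simp⟩
  | mul f g _ _ hf hg =>
    obtain ⟨m, n, hf⟩ := hf
    obtain ⟨m', n', hg⟩ := hg
    rcases hf with hf | hf
    · refine ⟨m + m', n + n', hg.imp ?_ ?_⟩ <;> intro hg x <;>
        rw [IsometryEquiv.mul_apply, hg, hf] <;> push_cast <;> ring
    · refine ⟨m - m', n - n', hg.symm.imp ?_ ?_⟩ <;> intro hg x <;>
        rw [IsometryEquiv.mul_apply, hg, hf] <;> push_cast <;> ring
  | inv g _ hg =>
    obtain ⟨m, n, hg | hg⟩ := hg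
    · refine ⟨-m, -n, .inl fun x => ?_⟩
      apply g.injective
      rw [IsometryEquiv.apply_inv_self, hg]
      push_cast; ring
    · refine ⟨m, n, .inr fun x => ?_⟩
      apply g.injective
      rw [IsometryEquiv.apply_inv_self, hg]
      ring

theorem coe_two_mul_add_two_mul (α : ℝ) (m n : ℤ) :
    ((2 * m + 2 * n * α : ℝ) : AddCircle (2 : ℝ)) = n • ((2 * α : ℝ) : AddCircle (2 : ℝ)) := by
  have h : (2 * m + 2 * n * α : ℝ) = n • (2 * α) + m • 2 := by simp only [zsmul_eq_mul]; ring
  rw [h, AddCircle.coe_add, AddCircle.coe_zsmul, AddCircle.coe_zsmul, AddCircle.coe_period]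
  simp

-- On the circle `g` is `x ↦ ±x + 2nα`. Its two terms are translates of `1_P(θ)` and `1_P(-θ)`, by
-- `n - 1` and `-n` steps of `2α` for a translation and by `-n` and `n - 1` steps for a reflection.
-- The total is `-1` in both cases, so the integral does not depend on `g`.
open MeasureTheory in
theorem exists_transfer_of_isometry {α : ℝ} {g : ℝ ≃ᵢ ℝ}
    (hg : g ∈ Subgroup.closure (fourIsometries α)) {P : Set ℝ} {a : ℝ}
    (hP : P ⊆ Set.Ioc a (a + 2)) (hm : NullMeasurableSet P) :
    ∃ G : AddCircle (2 : ℝ) → ℝ, Integrable G ∧ (∀ θ, ∃ z : ℤ, G θ = z) ∧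
      (∀ θ, G (θ - (2 * α : ℝ)) - G θ =
        (circleIndicator (g '' P) (θ + (2 * α : ℝ)) + circleIndicator (g '' P) (-θ)) -
          (circleIndicator P θ + circleIndicator P (-θ))) ∧
      ∫ θ, G θ = -∫ θ, circleIndicator P θ := by
  have hi := integrable_circleIndicator hP hm
  have hz := circleIndicator_integer P
  have hi' : Integrable (fun θ => circleIndicator P (-θ)) := hi.comp_neg
  have hz' : ∀ θ, ∃ z : ℤ, circleIndicator P (-θ) = z := fun θ => hz (-θ)
  have hint : ∫ θ, circleIndicator P (-θ) = ∫ θ, circleIndicator P θ :=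
    integral_neg_eq_self (circleIndicator P) volume
  obtain ⟨m, n, h | h⟩ := isometry_of_mem_closure_fourIsometries hg
  · obtain ⟨G, hG, hGz, hGs, hGi⟩ :=
      exists_integer_transfer hi hz ((2 * α : ℝ) : AddCircle (2 : ℝ)) (n - 1)
    obtain ⟨H, hH, hHz, hHs, hHi⟩ :=
      exists_integer_transfer hi' hz' ((2 * α : ℝ) : AddCircle (2 : ℝ)) (-n)
    refine ⟨fun θ => G θ + H θ, hG.add hH, fun θ => ?_, fun θ => ?_, ?_⟩
    · obtain ⟨u, hu⟩ := hGz θ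
      obtain ⟨v, hv⟩ := hHz θ
      exact ⟨u + v, by simp [hu, hv]⟩
    · have h1 := hGs θ
      have h2 := hHs θ
      rw [circleIndicator_translate (coe_two_mul_add_two_mul α m n) h,
        circleIndicator_translate (coe_two_mul_add_two_mul α m n) h]
      rw [show θ - (n - 1) • ((2 * α : ℝ) : AddCircle (2 : ℝ)) = θ + (2 * α : ℝ) - n • (2 * α : ℝ)
        by rw [sub_smul, one_smul]; abel] at h1
      rw [show -(θ - -n • ((2 * α : ℝ) : AddCircle (2 : ℝ))) = -θ - n • (2 * α : ℝ)
        by rw [neg_smul]; abel] at h2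
      linarith
    · rw [integral_add hG hH, hGi, hHi, hint]
      push_cast; ring
  · obtain ⟨G, hG, hGz, hGs, hGi⟩ :=
      exists_integer_transfer hi hz ((2 * α : ℝ) : AddCircle (2 : ℝ)) (-n)
    obtain ⟨H, hH, hHz, hHs, hHi⟩ :=
      exists_integer_transfer hi' hz' ((2 * α : ℝ) : AddCircle (2 : ℝ)) (n - 1)
    refine ⟨fun θ => G θ + H θ, hG.add hH, fun θ => ?_, fun θ => ?_, ?_⟩
    · obtain ⟨u, hu⟩ := hGz θ
      obtain ⟨v, hv⟩ := hHz θ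
      exact ⟨u + v, by simp [hu, hv]⟩
    · have h1 := hGs θ
      have h2 := hHs θ
      rw [circleIndicator_reflect (coe_two_mul_add_two_mul α m n) h,
        circleIndicator_reflect (coe_two_mul_add_two_mul α m n) h]
      rw [show θ - -n • ((2 * α : ℝ) : AddCircle (2 : ℝ)) = n • (2 * α : ℝ) - -θ
        by rw [neg_smul]; abel] at h1
      rw [show -(θ - (n - 1) • ((2 * α : ℝ) : AddCircle (2 : ℝ))) =
        n • (2 * α : ℝ) - (θ + (2 * α : ℝ)) by rw [sub_smul, one_smul]; abel] at h2
      linarith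
    · rw [integral_add hG hH, hGi, hHi, hint]
      push_cast; ring

open MeasureTheory in
theorem not_measurablyEquidecomposable_closure_fourIsometries {α : ℝ} (hα : Irrational α) :
    ¬ MeasurablyEquidecomposable (Subgroup.closure (fourIsometries α) : Set (ℝ ≃ᵢ ℝ))
        (Set.Icc 0 1) (Set.Icc α (1 + α)) := by
  rintro ⟨k, P, Q, g, ⟨hP, hQ, hg, hPQ⟩, hPm, -⟩
  have hA : Set.Icc (0 : ℝ) 1 ⊆ Set.Ioc (-1) (-1 + 2) := fun x hx =>
    ⟨by linarith [hx.1], by linarith [hx.2]⟩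
  have hB : Set.Icc α (1 + α) ⊆ Set.Ioc (α - 1) (α - 1 + 2) := fun x hx =>
    ⟨by linarith [hx.1], by linarith [hx.2]⟩
  have hPA : ∀ i, P i ⊆ Set.Icc 0 1 := fun i => hP.1 ▸ Set.subset_iUnion P i
  choose G hG hGz hGs hGi using fun i =>
    exists_transfer_of_isometry (hg i) ((hPA i).trans hA) (hPm i)
  have hBA : ∀ θ : AddCircle (2 : ℝ), circleIndicator (Set.Icc α (1 + α)) θ =
      circleIndicator (Set.Icc 0 1) (θ - (α : AddCircle (2 : ℝ))) := by
    intro θ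
    have : Set.Icc α (1 + α) = (fun x => x + α) '' Set.Icc 0 1 := by simp
    rw [this, circleIndicator_translate rfl fun x => rfl]
  -- The tiling identity at `θ + α` is the one needed for `B = A + α`.
  have hshift := (measurePreserving_add_right volume
    (α : AddCircle (2 : ℝ))).quasiMeasurePreserving.ae ae_circleIndicator_add_neg
  have hinv : (fun θ => ∑ i, G i θ) ∘ (fun θ => θ - ((2 * α : ℝ) : AddCircle (2 : ℝ)))
      =ᵐ[volume] fun θ => ∑ i, G i θ := by
    filter_upwards [ae_circleIndicator_add_neg, hshift] with θ h1 h2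
    rw [← sub_eq_zero, Function.comp_apply, ← Finset.sum_sub_distrib]
    simp only [hGs, hPQ]
    rw [Finset.sum_sub_distrib, Finset.sum_add_distrib, Finset.sum_add_distrib,
      hP.sum_circleIndicator hA, hP.sum_circleIndicator hA, hQ.sum_circleIndicator hB,
      hQ.sum_circleIndicator hB, h1, hBA, hBA]
    rw [show θ + ((2 * α : ℝ) : AddCircle (2 : ℝ)) - (α : AddCircle (2 : ℝ)) = θ + (α : ℝ) by
        rw [two_mul, AddCircle.coe_add]; abel,
      show -θ - (α : AddCircle (2 : ℝ)) = -(θ + (α : ℝ)) by abel, h2, sub_self]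
  obtain ⟨c, hc⟩ := (ergodic_sub_two_mul hα).exists_integral_eq_intCast_mul
    (integrable_finsetSum _ fun i _ => hG i) (fun θ => by
      choose z hz using fun i => hGz i θ
      exact ⟨∑ i, z i, by simp [hz]⟩) hinv
  have hone : ∑ i, ∫ θ, circleIndicator (P i) θ = 1 := by
    rw [← integral_finsetSum _ fun i _ => integrable_circleIndicator ((hPA i).trans hA) (hPm i)]
    simp only [hP.sum_circleIndicator hA]
    rw [integral_circleIndicator hA measurableSet_Icc.nullMeasurableSet]
    simp
  rw [integral_finsetSum _ fun i _ => hG i] at hc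
  simp only [hGi] at hc
  rw [Finset.sum_neg_distrib, hone, Measure.real, AddCircle.measure_univ] at hc
  norm_num at hc
  -- Parity: the circle has length 2, while `A` has length 1.
  have : (-1 : ℤ) = c * 2 := by exact_mod_cast (by push_cast; exact hc : ((-1 : ℤ) : ℝ) = ((c * 2 : ℤ) : ℝ))
  omega

/-! ### Constructing the equidecomposition -/

/-- Each piece collects the points for which the same isometry was chosen. -/
theorem Equidecomposable.of_bijective {X : Type*} [PseudoEMetricSpace X] {Γ : Set (X ≃ᵢ X)}
    (hΓ : Γ.Finite) {A B : Set X} (f : A → B) (hf : f.Bijective)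
    (h : ∀ a : A, ∃ γ ∈ Γ, γ (a : X) = f a) : Equidecomposable Γ A B := by
  have : Finite Γ := hΓ
  obtain ⟨k, ⟨e⟩⟩ := Finite.exists_equiv_fin Γ
  choose c hcΓ hc using h
  let P : Fin k → Set X := fun i => (↑) '' {a : A | e ⟨c a, hcΓ a⟩ = i}
  have himage : ∀ i (a : A), e ⟨c a, hcΓ a⟩ = i → (e.symm i : X ≃ᵢ X) (a : X) = f a := by
    rintro _ a rfl
    rw [e.symm_apply_apply, hc]
  refine ⟨k, P, fun i => (e.symm i : X ≃ᵢ X) '' P i, fun i => e.symm i,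
    ⟨?_, ?_⟩, ⟨?_, ?_⟩, fun i => (e.symm i).2, fun _ => rfl⟩
  · ext x
    simp only [P, Set.mem_iUnion]
    constructor
    · rintro ⟨i, a, -, rfl⟩
      exact a.2
    · exact fun hx => ⟨_, ⟨x, hx⟩, rfl, rfl⟩
  · intro i j hij
    refine Set.disjoint_left.2 ?_
    rintro _ ⟨a, rfl, rfl⟩ ⟨b, rfl, hb⟩
    exact hij (by rw [Subtype.ext hb])
  · ext y
    simp only [P, Set.mem_iUnion]
    constructor
    · rintro ⟨i, _, ⟨a, ha, rfl⟩, rfl⟩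
      rw [himage i a ha]
      exact (f a).2
    · intro hy
      obtain ⟨a, ha⟩ := hf.2 ⟨y, hy⟩
      exact ⟨_, a, ⟨a, rfl, rfl⟩, by rw [himage _ a rfl, ha]⟩
  · intro i j hij
    refine Set.disjoint_left.2 ?_
    rintro _ ⟨_, ⟨a, ha, rfl⟩, rfl⟩ ⟨_, ⟨b, hb, rfl⟩, h⟩
    rw [himage i a ha, himage j b hb] at h
    obtain rfl := hf.1 (Subtype.ext h)
    exact hij (ha.symm.trans hb)

theorem Irrational.coeff_unique {α : ℝ} (hα : Irrational α) {m n m' n' : ℤ}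
    (h : (m + n * α : ℝ) = m' + n' * α) : n = n' := by
  by_contra hn
  refine (hα.intCast_mul (sub_ne_zero.2 hn)).ne_int (m' - m) ?_
  push_cast
  linarith

/-- A choice, invariant under the translations by `2` and `2α`, of one point from each pair
`{x, -x}` of nonintegers. -/
theorem exists_translation_invariant_half {α : ℝ} (hα : Irrational α) :
    ∃ p : ℝ → Prop, (∀ x (m : ℤ), p x → p (x + 2 * m)) ∧ (∀ x, p x → p (x + 2 * α)) ∧
      ∀ x : ℝ, (∀ m : ℤ, x ≠ m) → (p (-x) ↔ ¬ p x) := by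
  let H : AddSubgroup ℝ := AddSubgroup.closure {2, 2 * α}
  have h2 : (2 : ℝ) ∈ H := AddSubgroup.subset_closure (by simp)
  have h2α : 2 * α ∈ H := AddSubgroup.subset_closure (by simp)
  have hH : ∀ x ∈ H, ∃ m n : ℤ, x = 2 * m + 2 * n * α := by
    intro x hx
    obtain ⟨m, n, h⟩ := AddSubgroup.mem_closure_pair.1 hx
    refine ⟨m, n, ?_⟩
    rw [← h]; simp only [zsmul_eq_mul]; ring
  let r : ℝ → ℝ := fun x => (x : ℝ ⧸ H).out
  have hr : ∀ x y, r x = r y → y - x ∈ H := by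
    intro x y h
    have : (x : ℝ ⧸ H) = y := by
      rw [← QuotientAddGroup.out_eq' (x : ℝ ⧸ H), ← QuotientAddGroup.out_eq' (y : ℝ ⧸ H)]
      exact congrArg _ h
    rw [QuotientAddGroup.eq] at this
    rwa [neg_add_eq_sub] at this
  have hr' : ∀ x, ∀ h ∈ H, r (x + h) = r x := by
    intro x h hh
    have : ((x + h : ℝ) : ℝ ⧸ H) = x := by
      rw [eq_comm, QuotientAddGroup.eq]; simpa using hh
    simp only [r, this]
  -- `L` holds exactly when `x` and `-x` lie in the same coset of `H`. Off `L`, comparing coset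
  -- representatives selects one of the two cosets. On `L` the sign of `n` decides, which is
  -- preserved only by forward translation by `2α`; that is all that is required.
  let L : ℝ → Prop := fun x => ∃ m n : ℤ, x = m + n * α
  let p : ℝ → Prop := fun x =>
    (∃ m n : ℤ, 0 ≤ n ∧ x = m + n * α) ∨ (¬ L x ∧ r x < r (-x))
  have shift : ∀ x, ∀ i j : ℤ, 0 ≤ j → p x → p (x + (2 * i + 2 * j * α)) := by
    intro x i j hj hx
    rcases hx with ⟨m, n, hn, rfl⟩ | ⟨hL, hlt⟩
    · exact .inl ⟨m + 2 * i, n + 2 * j, by lia, by push_cast; ring⟩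
    · have hmem : (2 * i + 2 * j * α : ℝ) ∈ H := by
        have := H.add_mem (H.zsmul_mem h2 i) (H.zsmul_mem h2α j)
        simp only [zsmul_eq_mul] at this
        convert this using 1; ring
      refine .inr ⟨?_, ?_⟩
      · rintro ⟨m, n, h⟩
        exact hL ⟨m - 2 * i, n - 2 * j, by push_cast; linarith⟩
      · rwa [hr' _ _ hmem, neg_add, hr' _ _ (H.neg_mem hmem)]
  refine ⟨p, fun x m hx => ?_, fun x hx => ?_, fun x hx => ?_⟩
  · simpa using shift x m 0 le_rfl hx
  · simpa using shift x 0 1 zero_le_one hx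
  · by_cases hL : L x
    · obtain ⟨m, n, rfl⟩ := hL
      have hn : n ≠ 0 := by rintro rfl; exact hx m (by simp)
      have h1 : p (m + n * α) ↔ 0 ≤ n := by
        refine ⟨?_, fun h => .inl ⟨m, n, h, rfl⟩⟩
        rintro (⟨m', n', h, e⟩ | ⟨h, -⟩)
        · rwa [hα.coeff_unique e]
        · exact absurd ⟨m, n, rfl⟩ h
      have h2 : p (-(m + n * α)) ↔ 0 ≤ -n := by
        refine ⟨?_, fun h => .inl ⟨-m, -n, h, by push_cast; ring⟩⟩
        rintro (⟨m', n', h, e⟩ | ⟨h, -⟩)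
        · have : ((-m : ℤ) + (-n : ℤ) * α : ℝ) = m' + n' * α := by rw [← e]; push_cast; ring
          rwa [hα.coeff_unique this]
        · exact absurd ⟨-m, -n, by push_cast; ring⟩ h
      rw [h1, h2]; lia
    · have hL' : ¬ L (-x) := by
        rintro ⟨m, n, h⟩
        exact hL ⟨-m, -n, by push_cast; linarith⟩
      have h1 : ∀ y, ¬ L y → (p y ↔ r y < r (-y)) := by
        refine fun y hy => ⟨?_, fun h => .inr ⟨hy, h⟩⟩
        rintro (⟨m, n, -, h⟩ | ⟨-, h⟩)
        · exact absurd ⟨m, n, h⟩ hy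
        · exact h
      have hne : r (-x) ≠ r x := by
        intro h
        obtain ⟨m, n, e⟩ := hH _ (hr _ _ h)
        exact hL ⟨m, n, by linarith⟩
      rw [h1 x hL, h1 _ hL', neg_neg, not_lt, lt_iff_le_and_ne, and_iff_left hne]

/-- There is an injection of `[0, 1]` into itself which moves each point by `α`
in one of the two directions, and then reflects it back at the endpoints if needed. -/
theorem exists_injOn_reflected_shift {α : ℝ} (hα : Irrational α) (hα0 : 0 < α) (hα1 : α < 1) :
    ∃ F : ℝ → ℝ, Set.InjOn F (Set.Icc 0 1) ∧ Set.MapsTo F (Set.Icc 0 1) (Set.Icc 0 1) ∧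
      ∀ x ∈ Set.Icc (0 : ℝ) 1, F x = x + α ∨ F x = 2 - (x + α) ∨ F x = x - α ∨ F x = α - x := by
  classical
  obtain ⟨p, hp2, hpα, hpneg⟩ := exists_translation_invariant_half hα
  let T : ℝ → ℝ := fun x => if p x then x + α else x - α
  let F : ℝ → ℝ := fun x => if T x ≤ 1 then |T x| else 2 - T x
  have hT : ∀ x, T x = x + α ∧ p x ∨ T x = x - α ∧ ¬ p x := fun x => by
    by_cases h : p x <;> simp [T, h]
  have hadd : ∀ x y (m : ℤ), T x = T y + 2 * m → ∃ k : ℤ, x = y + 2 * k := by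
    intro x y m h
    rcases hT x with ⟨hx, px⟩ | ⟨hx, px⟩ <;> rcases hT y with ⟨hy, py⟩ | ⟨hy, py⟩ <;>
      rw [hx, hy] at h
    · exact ⟨m, by linarith⟩
    -- Moves in opposite directions collide only if one point is the other plus `2α` modulo 2, and
    -- `p` would carry over.
    · refine absurd (hp2 _ (-m) (hpα x px)) ?_
      rwa [show x + 2 * α + 2 * ((-m : ℤ) : ℝ) = y by push_cast; linarith]
    · refine absurd (hp2 _ m (hpα y py)) ?_
      rwa [show y + 2 * α + 2 * (m : ℝ) = x by linarith]
    · exact ⟨m, by linarith⟩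
  have hneg : ∀ y : ℝ, (∀ m : ℤ, y ≠ m) → T (-y) = -T y := by
    intro y hy
    have := hpneg y hy
    by_cases h : p y
    · simp [T, h, this]; ring
    · simp [T, h, this]; ring
  have hsub : ∀ x y (m : ℤ), T x = -T y + 2 * m → ∃ k : ℤ, x = -y + 2 * k := by
    intro x y m h
    by_cases hy : ∀ m : ℤ, y ≠ m
    · rw [← hneg y hy] at h
      exact hadd _ _ _ h
    by_cases hx : ∀ m : ℤ, x ≠ m
    · obtain ⟨k, hk⟩ := hadd y (-x) m (by rw [hneg x hx]; linarith)
      exact ⟨k, by linarith⟩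
    -- At integers `T` need not be odd. Equal directions contradict irrationality, and opposite ones
    -- give the claim directly.
    push Not at hx hy
    obtain ⟨a, rfl⟩ := hx
    obtain ⟨b, rfl⟩ := hy
    rcases hT a with ⟨hx, -⟩ | ⟨hx, -⟩ <;> rcases hT b with ⟨hy, -⟩ | ⟨hy, -⟩ <;>
      rw [hx, hy] at h
    · have := hα.coeff_unique (m := a + b) (n := 2) (m' := 2 * m) (n' := 0)
        (by push_cast; linarith)
      lia
    · exact ⟨m, by linarith⟩
    · exact ⟨m, by linarith⟩
    · have := hα.coeff_unique (m := a + b) (n := 0) (m' := 2 * m) (n' := 2)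
        (by push_cast; linarith)
      lia
  have hF : ∀ x, ∃ m : ℤ, F x = T x + 2 * m ∨ F x = -T x + 2 * m := by
    intro x
    simp only [F]
    split_ifs
    · rcases abs_choice (T x) with h | h
      · exact ⟨0, .inl (by simp [h])⟩
      · exact ⟨0, .inr (by simp [h])⟩
    · exact ⟨1, .inr (by push_cast; ring)⟩
  refine ⟨F, fun x hx y hy h => ?_, fun x hx => ?_, fun x hx => ?_⟩
  · have key : ∃ k : ℤ, x = y + 2 * k ∨ x = -y + 2 * k := by
      obtain ⟨m, hm⟩ := hF x
      obtain ⟨n, hn⟩ := hF y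
      rcases hm with hm | hm <;> rcases hn with hn | hn <;> rw [hm, hn] at h
      · obtain ⟨k, hk⟩ := hadd x y (n - m) (by push_cast; linarith)
        exact ⟨k, .inl hk⟩
      · obtain ⟨k, hk⟩ := hsub x y (n - m) (by push_cast; linarith)
        exact ⟨k, .inr hk⟩
      · obtain ⟨k, hk⟩ := hsub x y (m - n) (by push_cast; linarith)
        exact ⟨k, .inr hk⟩
      · obtain ⟨k, hk⟩ := hadd x y (m - n) (by push_cast; linarith)
        exact ⟨k, .inl hk⟩
    obtain ⟨hx0, hx1⟩ := hx
    obtain ⟨hy0, hy1⟩ := hy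
    obtain ⟨k, hk | hk⟩ := key
    · have h1 : (k : ℝ) < 1 := by linarith
      have h2 : (-1 : ℝ) < k := by linarith
      have h3 : k < 1 := by exact_mod_cast h1
      have h4 : -1 < k := by exact_mod_cast h2
      obtain rfl : k = 0 := by lia
      simpa using hk
    · have h1 : (k : ℝ) < 2 := by linarith
      have h2 : (-1 : ℝ) < k := by linarith
      have h3 : k < 2 := by exact_mod_cast h1
      have h4 : -1 < k := by exact_mod_cast h2
      -- In `[0,1]`, `x = -y` forces both to be `0`, and `x = 2 - y` forces both to be `1`.
      obtain rfl | rfl : k = 0 ∨ k = 1 := by lia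
      · push_cast at hk; linarith
      · push_cast at hk; linarith
  · obtain ⟨hx0, hx1⟩ := hx
    have h1 : -1 ≤ T x ∧ T x ≤ 2 := by
      rcases hT x with ⟨h, -⟩ | ⟨h, -⟩ <;> rw [h] <;> constructor <;> linarith
    simp only [F]
    split_ifs with h
    · exact ⟨abs_nonneg _, abs_le.2 ⟨h1.1, h⟩⟩
    · constructor <;> linarith
  · obtain ⟨hx0, hx1⟩ := hx
    simp only [F]
    rcases hT x with ⟨h, -⟩ | ⟨h, -⟩ <;> rw [h]
    · rw [abs_of_nonneg (by linarith)]
      split_ifs <;> simp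
    · rw [if_pos (by linarith)]
      rcases abs_choice (x - α) with h | h <;> simp [h]

theorem equidecomposable_fourIsometries {α : ℝ} (hα : Irrational α) (hα0 : 0 < α) (hα1 : α < 1) :
    Equidecomposable (fourIsometries α) (Set.Icc 0 1) (Set.Icc α (1 + α)) := by
  obtain ⟨F, hinj, hmaps, hF⟩ := exists_injOn_reflected_shift hα hα0 hα1
  have hsub : ∀ b ∈ Set.Icc α (1 + α), b - α ∈ Set.Icc (0 : ℝ) 1 := fun b hb =>
    ⟨by linarith [hb.1], by linarith [hb.2]⟩
  -- Adding `α` turns the four possible values of `F` into the four maps of `Γ`; precomposing with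
  -- `b ↦ b - α` gives their inverses.
  let f : Set.Icc (0 : ℝ) 1 → Set.Icc α (1 + α) := fun a =>
    ⟨F a + α, by linarith [(hmaps a.2).1], by linarith [(hmaps a.2).2]⟩
  let g : Set.Icc α (1 + α) → Set.Icc (0 : ℝ) 1 := fun b => ⟨F (b - α), hmaps (hsub b b.2)⟩
  have hf : f.Injective := fun a b h =>
    Subtype.ext (hinj a.2 b.2 (add_right_cancel (congrArg Subtype.val h)))
  have hg : g.Injective := fun a b h =>
    Subtype.ext (sub_left_injective (hinj (hsub a a.2) (hsub b b.2) (congrArg Subtype.val h)))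
  have hedge : ∀ x y : ℝ, y = x ∨ y = x + 2 * α ∨ y = 2 - x ∨ y = 2 * α - x →
      ∃ γ ∈ fourIsometries α, γ x = y := by
    rintro x y (rfl | rfl | rfl | rfl)
    · exact ⟨_, .inl rfl, rfl⟩
    · exact ⟨_, .inr (.inl rfl), rfl⟩
    · exact ⟨_, .inr (.inr (.inl rfl)), rfl⟩
    · exact ⟨_, .inr (.inr (.inr rfl)), rfl⟩
  have hfR : ∀ a : Set.Icc (0 : ℝ) 1, ∃ γ ∈ fourIsometries α, γ (a : ℝ) = f a := fun a => hedge _ _ (by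
    have := hF a a.2
    simp only [f]
    grind)
  have hgR : ∀ b, ∃ γ ∈ fourIsometries α, γ (g b : ℝ) = b := fun b => hedge _ _ (by
    have := hF (b - α) (hsub b b.2)
    simp only [g]
    grind)
  obtain ⟨h, hbij, hh⟩ := Function.Embedding.schroeder_bernstein_of_rel hf hg
    (fun a b => ∃ γ ∈ fourIsometries α, γ (a : ℝ) = b) hfR hgR
  exact .of_bijective (by simp [fourIsometries]) h hbij hh

theorem theorem1 (α : ℝ) (hα : Irrational α) (hα0 : 0 < α) (hα1 : α < 1) :
    Equidecomposable (fourIsometries α) (Set.Icc 0 1) (Set.Icc α (1 + α)) ∧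
    ¬ MeasurablyEquidecomposable
        (Subgroup.closure (fourIsometries α) : Set (ℝ ≃ᵢ ℝ))
        (Set.Icc 0 1) (Set.Icc α (1 + α)) :=
  ⟨equidecomposable_fourIsometries hα hα0 hα1,
    not_measurablyEquidecomposable_closure_fourIsometries hα⟩
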